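/- **Definitions.** Let $\Pr$ be a probability distribution of binary random variables $X_1,\dots,X_n$. Its probability generating polynomial is $$g(z_1,\dots,z_n)=\sum_{S\subseteq\{1,\dots,n\}}\Pr(\{X_i=1\}_{i\in S},\{X_i=0\}_{i\notin S})\prod_{i\in S}z_i\in\mathbb{R}[z_1,\dots,z_n].$$ A probabilistic generating circuit (PGC) is a finite directed acyclic graph, with edges directed from children to parents, whose nodes are leaves (a variable $z_i$ or a real constant), sum nodes with real-weighted edges from their children, and product nodes with unweighted edges from their children, and in which exactly one node, the root, has out-degree $0$. A leaf represents the polynomial $z_i$ or the constant, a sum node the weighted sum and a product node the product of the polynomials represented by its children; the PGC represents the polynomial represented by its root. The size of a PGC is the number of its edges. A PGC represents $\Pr$ if it represents the probability generating polynomial of $\Pr$. Time is the number of steps of a real RAM, which has registers for natural numbers and for real numbers, direct and indirect addressing, and conditional jumps; it adds, subtracts, multiplies and divides real numbers exactly, and adds and subtracts natural numbers, in one step per operation. A PGC is given to it as the list of its nodes in a bottom-up order (children before parents), with the kind, the children, and the real constant or edge weights of each node; sets $A,B$ are given by one number for each variable. **Theorem.** There are a single real RAM program and a constant $C$ such that the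 following holds. For every $n$, every PGC of size $m$ that represents a probability distribution $\Pr$ of $n$ binary random variables, and all disjoint $A,B\subseteq\{1,\dots,n\}$, the program, given the PGC and $A,B$, halts with the output $$\Pr(\{X_i=1\}_{i\in A},\{X_i=0\}_{i\in B})$$ (for $A\cup B=\{1,\dots,n\}$ this is the likelihood of an assignment), in time $O(mn\log n\log\log n)$: the number of steps is at most $C\,mn\log n\log\log n$ whenever $m\ge1$ and $n\ge3$, and in all cases, including the degenerate ones, at most $C\max(1,m)\max(1,n)\max(1,\log n)\max(1,\log\log n)$ (where $\max(1,\log n)=\max(1,\log\log n)=1$ for $n\le 1$). -/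

import Mathlib

open MeasureTheory

noncomputable section

/-! ### Probability generating polynomials of binary random variables -/

/-- The marginal probability `Pr({X_i = 1}_{i ∈ A}, {X_i = 0}_{i ∈ B})` of a probability
distribution `μ` of binary random variables `X_1, …, X_n`
(the value 1 is `true`, the value 0 is `false`). -/
def marginal {n : ℕ} (μ : Measure (Fin n → Bool)) (A B : Finset (Fin n)) : ℝ :=
  μ.real {x | (∀ i ∈ A, x i = true) ∧ (∀ i ∈ B, x i = false)}

/-- The probability generating polynomial `∑_S α_S ∏_{i ∈ S} z_i`, where
`α_S = Pr({X_i = 1}_{i ∈ S}, {X_i = 0}_{i ∉ S})`. -/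
def generatingPolynomial {n : ℕ} (μ : Measure (Fin n → Bool)) : MvPolynomial (Fin n) ℝ :=
  ∑ S : Finset (Fin n), MvPolynomial.C (marginal μ S Sᶜ) * ∏ i ∈ S, MvPolynomial.X i

/-! ### Probabilistic generating circuits -/

/-- What stands at a node of a probabilistic generating circuit with node set `V`: a leaf
(a variable `z_i` or a constant), a sum over weighted edges, or a product over unweighted edges.
The lists hold the children of the node. -/
inductive PGCGate (n : ℕ) (V : Type) : Type
  | var (i : Fin n)
  | const (c : ℝ)
  | sum (l : List (ℝ × V))
  | prod (l : List V)

namespace PGCGate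

variable {n : ℕ} {V : Type}

/-- The children of a node; each entry of the list is one edge of the circuit. -/
def children : PGCGate n V → List V
  | var _ => []
  | const _ => []
  | sum l => l.map Prod.snd
  | prod l => l

/-- The polynomial represented by a node, from the polynomials represented by its children. -/
def combine : PGCGate n V → (V → MvPolynomial (Fin n) ℝ) → MvPolynomial (Fin n) ℝ
  | var i, _ => MvPolynomial.X i
  | const c, _ => MvPolynomial.C c
  | sum l, f => (l.map fun a => MvPolynomial.C a.1 * f a.2).sum
  | prod l, f => (l.map f).prod

theorem combine_congr (g : PGCGate n V) (f f' : V → MvPolynomial (Fin n) ℝ)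
    (h : ∀ u ∈ g.children, f u = f' u) : g.combine f = g.combine f' := by
  cases g with
  | var i => rfl
  | const c => rfl
  | sum l =>
    refine congrArg List.sum (List.map_congr_left fun a ha => ?_)
    rw [h a.2 (List.mem_map_of_mem ha)]
  | prod l => exact congrArg List.prod (List.map_congr_left h)

end PGCGate

/-- A probabilistic generating circuit in the variables `z_1, …, z_n`: a finite directed acyclic
graph of gates (edges go from children to parents) in which exactly one node, the root, has
out-degree 0. -/
structure PGC (n : ℕ) : Type 1 where
  Node : Type
  [fintypeNode : Fintype Node]
  gate : Node → PGCGate n Node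
  acyclic : WellFounded fun u v => u ∈ (gate v).children
  root : Node
  no_parent_iff : ∀ u, (∀ v, u ∉ (gate v).children) ↔ u = root

namespace PGC

attribute [instance] PGC.fintypeNode

variable {n : ℕ}

/-- The size of a circuit: its number of edges. -/
def size (P : PGC n) : ℕ := ∑ v, (P.gate v).children.length

open Classical in
/-- The polynomial represented by a node, by recursion along the edges. -/
def nodePolynomial (P : PGC n) : P.Node → MvPolynomial (Fin n) ℝ :=
  P.acyclic.fix fun v f =>
    (P.gate v).combine fun u => if h : u ∈ (P.gate v).children then f u h else 0

theorem nodePolynomial_eq (P : PGC n) (v : P.Node) :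
    P.nodePolynomial v = (P.gate v).combine P.nodePolynomial := by
  unfold nodePolynomial
  rw [WellFounded.fix_eq]
  refine PGCGate.combine_congr _ _ _ fun u hu => ?_
  rw [dif_pos hu]

/-- The polynomial represented by a circuit is the one represented by its root. -/
def polynomial (P : PGC n) : MvPolynomial (Fin n) ℝ := P.nodePolynomial P.root

/-- A bottom-up (topological) numbering of the nodes: children come before their parents. -/
structure BottomUpOrder (P : PGC n) where
  toEquiv : Fin (Fintype.card P.Node) ≃ P.Node
  lt_of_child : ∀ u v, u ∈ (P.gate v).children → toEquiv.symm u < toEquiv.symm v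

/-- Every circuit has a bottom-up numbering. -/
theorem nonempty_bottomUpOrder (P : PGC n) : Nonempty P.BottomUpOrder := by
  classical
  let r : P.Node → P.Node → Prop := fun u v => u ∈ (P.gate v).children
  have hwf : WellFounded (Relation.TransGen r) := P.acyclic.transGen
  have hirr : ∀ a, ¬ Relation.TransGen r a a := fun a h => hwf.irrefl.irrefl a h
  have hpo : IsPartialOrder P.Node (Relation.ReflTransGen r) :=
    { refl := fun _ => .refl
      trans := fun _ _ _ => .trans
      antisymm := fun a b hab hba => by
        by_contra hne
        have h1 := (Relation.reflTransGen_iff_eq_or_transGen.1 hab).resolve_left (Ne.symm hne)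
        exact hirr a (h1.trans_left hba) }
  obtain ⟨s, hs, hrs⟩ := extend_partialOrder (Relation.ReflTransGen r)
  let L : LinearOrder P.Node :=
    { le := s
      le_refl := hs.refl
      le_trans := hs.trans
      le_antisymm := hs.antisymm
      le_total := hs.total
      toDecidableLE := Classical.decRel _ }
  let e := monoEquivOfFin P.Node rfl
  refine ⟨⟨e.toEquiv, fun u v huv => ?_⟩⟩
  have hlt : u < v := lt_of_le_of_ne (hrs _ _ (Relation.ReflTransGen.single huv))
    fun h => hirr v (.single (h ▸ huv))
  exact e.symm.lt_iff_lt.2 hlt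

end PGC

/-! ### The real RAM

Registers hold natural numbers (used for indices and control) or real numbers.  Every instruction,
in particular every exact arithmetic operation on real numbers, takes one step.  The input
consists of a read-only array of natural numbers and a read-only array of real numbers. -/

namespace RealRAM

/-- The instructions.  `w i` and `r i` are the `i`-th natural and real register, and `l` is the
position of an instruction in the program. -/
inductive Instr : Type
  /-- `w i := c` -/
  | wconst (i c : ℕ)
  /-- `w i := w j + w k` -/
  | wadd (i j k : ℕ)
  /-- `w i := w j - w k`, or 0 when this is negative -/
  | wsub (i j k : ℕ)
  /-- `w i := w (w j)` -/
  | wload (i j : ℕ)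
  /-- `w (w i) := w j` -/
  | wstore (i j : ℕ)
  /-- `w i := ` the natural input number at position `w j` (0 beyond the end) -/
  | wread (i j : ℕ)
  /-- `r i := c` -/
  | rconst (i : ℕ) (c : ℤ)
  /-- `r i := r j + r k` -/
  | radd (i j k : ℕ)
  /-- `r i := r j - r k` -/
  | rsub (i j k : ℕ)
  /-- `r i := r j * r k` -/
  | rmul (i j k : ℕ)
  /-- `r i := r j / r k`; the machine gets stuck and never halts when `r k = 0` -/
  | rdiv (i j k : ℕ)
  /-- `r i := r (w j)` -/
  | rload (i j : ℕ)
  /-- `r (w i) := r j` -/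
  | rstore (i j : ℕ)
  /-- `r i := ` the real input number at position `w j` (0 beyond the end) -/
  | rread (i j : ℕ)
  /-- go to `l` -/
  | jump (l : ℕ)
  /-- go to `l` if `w i < w j` -/
  | jumpLt (i j l : ℕ)
  /-- go to `l` if `r i < 0` -/
  | jumpNeg (i l : ℕ)

/-- An input. -/
structure Input where
  words : List ℕ
  reals : List ℝ

/-- A configuration: the position in the program and the contents of the registers. -/
structure Config where
  pc : ℕ
  w : ℕ → ℕ
  r : ℕ → ℝ

/-- The configuration with `w i` overwritten, at the next instruction. -/
def Config.setW (c : Config) (i x : ℕ) : Config :=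
  { c with pc := c.pc + 1, w := Function.update c.w i x }

/-- The configuration with `r i` overwritten, at the next instruction. -/
def Config.setR (c : Config) (i : ℕ) (x : ℝ) : Config :=
  { c with pc := c.pc + 1, r := Function.update c.r i x }

open Classical in
/-- The effect of one instruction. -/
def exec (inp : Input) (c : Config) : Instr → Config
  | .wconst i a => c.setW i a
  | .wadd i j k => c.setW i (c.w j + c.w k)
  | .wsub i j k => c.setW i (c.w j - c.w k)
  | .wload i j => c.setW i (c.w (c.w j))
  | .wstore i j => c.setW (c.w i) (c.w j)
  | .wread i j => c.setW i (inp.words.getD (c.w j) 0)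
  | .rconst i a => c.setR i a
  | .radd i j k => c.setR i (c.r j + c.r k)
  | .rsub i j k => c.setR i (c.r j - c.r k)
  | .rmul i j k => c.setR i (c.r j * c.r k)
  | .rdiv i j k => if c.r k = 0 then c else c.setR i (c.r j / c.r k)
  | .rload i j => c.setR i (c.r (c.w j))
  | .rstore i j => c.setR (c.w i) (c.r j)
  | .rread i j => c.setR i (inp.reals.getD (c.w j) 0)
  | .jump l => { c with pc := l }
  | .jumpLt i j l => { c with pc := if c.w i < c.w j then l else c.pc + 1 }
  | .jumpNeg i l => { c with pc := if c.r i < 0 then l else c.pc + 1 }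

/-- One step of a program; nothing changes once the position is beyond its end. -/
def step (prog : List Instr) (inp : Input) (c : Config) : Config :=
  match prog[c.pc]? with
  | some a => exec inp c a
  | none => c

/-- The program starts at its first instruction, with all registers 0. -/
def start : Config := ⟨0, fun _ => 0, fun _ => 0⟩

/-- On the input `inp`, the program halts after at most `t` steps (its position is then beyond
its end), with the output `y` in the real register 0. -/
def ComputesWithin (prog : List Instr) (inp : Input) (t : ℕ) (y : ℝ) : Prop :=
  prog.length ≤ ((step prog inp)^[t] start).pc ∧ ((step prog inp)^[t] start).r 0 = y

end RealRAM

/-! ### Circuits and queries as inputs of the real RAM -/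

namespace PGCGate

variable {n : ℕ} {V : Type}

/-- The natural numbers that describe a gate: its kind, then the index of the variable, or the
number of the children and their indices. -/
def words (idx : V → ℕ) : PGCGate n V → List ℕ
  | var i => [0, i]
  | const _ => [1]
  | sum l => 2 :: l.length :: l.map fun a => idx a.2
  | prod l => 3 :: l.length :: l.map idx

/-- The real numbers that describe a gate: the constant of a constant leaf, the weights of the
edges into a sum node. -/
def reals : PGCGate n V → List ℝ
  | var _ => []
  | const c => [c]
  | sum l => l.map Prod.fst
  | prod _ => []

end PGCGate

/-- The input that consists of a circuit, whose nodes are listed bottom-up, and of the query for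
the marginal probability `Pr({X_i = 1}_{i ∈ A}, {X_i = 0}_{i ∈ B})`: the number of variables, the
number of nodes, one number for each variable (1 on `A`, 2 on `B`, else 0), and the gates. -/
def PGC.encode {n : ℕ} (P : PGC n) (e : P.BottomUpOrder) (A B : Finset (Fin n)) :
    RealRAM.Input where
  words := n :: Fintype.card P.Node ::
    ((List.ofFn fun i : Fin n => if i ∈ A then 1 else if i ∈ B then 2 else 0) ++
      (List.ofFn fun j => (P.gate (e.toEquiv j)).words fun v => (e.toEquiv.symm v : ℕ)).flatten)
  reals := (List.ofFn fun j => (P.gate (e.toEquiv j)).reals).flatten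

end

/-! Put k = |A|. Substitute x for the variables in A, 0 for those in B, and 1 for all others. In the
generating polynomial, the term of a set S vanishes if S meets B and otherwise becomes its
probability times x^|S ∩ A|. The result is a polynomial in x of degree at most k, and its
coefficient of x^k collects exactly the sets S that contain A and avoid B. That coefficient is the
wanted marginal.

The leading coefficient of a polynomial of degree at most k is its k-th forward difference divided
by k!, hence a fixed linear combination of its values at 0, …, k (`sum_differenceWeight_mul_pow`,
`sum_differenceWeight_mul_eval`). No polynomial arithmetic is needed: k + 1 numerical evaluations of
the circuit suffice. One bottom-up evaluation is linear in edges plus nodes, and there are at most m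
+ 1 nodes (`card_node_le_size`). The total is O(mn) in the nondegenerate range, and the logarithmic
factors are absorbed at the very end.

The rest is program verification: each loop has an invariant (`CountLoop`, `NodeLoop`, `PointLoop`),
and `computesWithin_marginalProgram` chains them with an explicit step count. -/

namespace RealRAM

/-! ### Runs of the machine with a step bound -/

/-- From `c`, the program reaches within `t` steps a configuration that satisfies `Q`. -/
def Reaches (prog : List Instr) (inp : Input) (c : Config) (t : ℕ) (Q : Config → Prop) : Prop :=
  ∃ s ≤ t, Q ((step prog inp)^[s] c)

namespace Reaches

variable {prog : List Instr} {inp : Input} {c : Config} {t t' : ℕ} {Q Q' : Config → Prop}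

theorem refl (h : Q c) : Reaches prog inp c t Q := ⟨0, Nat.zero_le _, h⟩

theorem mono (h : Reaches prog inp c t Q) (ht : t ≤ t') (hQ : ∀ c, Q c → Q' c) :
    Reaches prog inp c t' Q' :=
  let ⟨s, hs, hc⟩ := h
  ⟨s, hs.trans ht, hQ _ hc⟩

theorem trans (h : Reaches prog inp c t Q) (h' : ∀ c', Q c' → Reaches prog inp c' t' Q') :
    Reaches prog inp c (t + t') Q' := by
  obtain ⟨s, hs, hc⟩ := h
  obtain ⟨s', hs', hc'⟩ := h' _ hc
  refine ⟨s' + s, by omega, ?_⟩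
  rwa [Function.iterate_add_apply]

theorem next {a : Instr} (ha : prog[c.pc]? = some a)
    (h : Reaches prog inp (exec inp c a) t Q) : Reaches prog inp c (t + 1) Q := by
  obtain ⟨s, hs, hc⟩ := h
  refine ⟨s + 1, by omega, ?_⟩
  rw [Function.iterate_succ_apply]
  simpa only [step, ha] using hc

end Reaches

/-! ### The program and its scratch registers -/

/-- The program: it evaluates the circuit at `k + 1` points, where `k` is the number of variables
in `A`, and recovers the leading coefficient as a `k`-th finite difference. -/
def marginalProgram : List Instr := [
  -- initialization
  .wconst 7 1, .wconst 12 8, .wconst 13 2, .wread 0 8, .wread 1 7,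
  .wadd 14 0 13, .wconst 5 2, .rconst 1 1, .rconst 2 1,
  -- position 9: count the elements of `A` and compute the first weight
  .jumpLt 5 14 11, .jump 20, .wread 9 5, .wadd 5 5 7, .jumpLt 9 7 9,
  .jumpLt 7 9 9, .wadd 2 2 7, .radd 3 3 1, .rsub 6 7 2, .rdiv 2 6 3, .jump 9,
  -- position 20: loop over the evaluation points
  .jumpLt 2 3 84, .wadd 5 14 8, .wconst 6 0, .wconst 4 0,
  -- position 24: loop over the nodes
  .jumpLt 4 1 26, .jump 71, .wread 9 5, .wadd 5 5 7, .jumpLt 9 7 58, .jumpLt 9 13 55,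
  .wread 10 5, .wadd 5 5 7, .wadd 10 10 5, .jumpLt 13 9 46,
  -- position 34: sum node
  .rconst 5 0, .jumpLt 5 10 37, .jump 67, .wread 11 5, .wadd 5 5 7, .wadd 11 11 12,
  .rload 6 11, .rread 7 6, .wadd 6 6 7, .rmul 6 6 7, .radd 5 5 6, .jump 35,
  -- position 46: product node
  .rconst 5 1, .jumpLt 5 10 49, .jump 67, .wread 11 5, .wadd 5 5 7, .wadd 11 11 12,
  .rload 6 11, .rmul 5 5 6, .jump 47,
  -- position 55: constant
  .rread 5 6, .wadd 6 6 7, .jump 67,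
  -- position 58: variable
  .wread 11 5, .wadd 5 5 7, .wadd 11 11 13, .wread 11 11, .rconst 5 0, .jumpLt 7 11 67,
  .radd 5 5 4, .jumpLt 8 11 67, .rconst 5 1,
  -- position 67: store the value of the node
  .wadd 11 4 12, .rstore 11 5, .wadd 4 4 7, .jump 24,
  -- position 71: add the weighted value of the root and update the weight
  .wadd 11 1 12, .wsub 11 11 7, .rload 5 11, .rmul 5 5 2, .radd 0 0 5, .rmul 6 2 3,
  .radd 4 4 1, .rdiv 6 6 4, .rconst 7 0, .rsub 2 7 6, .rsub 3 3 1, .wadd 3 3 7, .jump 20]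

/-- The registers of `c` and `c'` differ at most in the scratch registers that are used to
compute the value of a gate. -/
structure SameBase (c c' : Config) : Prop where
  w : ∀ i, i ≠ 5 → i ≠ 6 → i ≠ 9 → i ≠ 10 → i ≠ 11 → c'.w i = c.w i
  r : ∀ i, i ≠ 5 → i ≠ 6 → i ≠ 7 → c'.r i = c.r i

theorem SameBase.trans {c c' c'' : Config} (h : SameBase c c') (h' : SameBase c' c'') :
    SameBase c c'' :=
  ⟨fun i h1 h2 h3 h4 h5 => (h'.w i h1 h2 h3 h4 h5).trans (h.w i h1 h2 h3 h4 h5),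
    fun i h1 h2 h3 => (h'.r i h1 h2 h3).trans (h.r i h1 h2 h3)⟩

/-! ### Evaluating a single gate -/

theorem getD_of_drop_eq_cons {α : Type*} {L l : List α} {i : ℕ} {a d : α}
    (h : L.drop i = a :: l) : L.getD i d = a := by
  have := congrArg List.head? h
  simp at this
  simp [this]

theorem drop_succ_of_drop_eq_cons {α : Type*} {L l : List α} {i : ℕ} {a : α}
    (h : L.drop i = a :: l) : L.drop (i + 1) = l := by
  rw [← List.tail_drop, h, List.tail_cons]

section Gate

variable {n : ℕ} {V : Type} {inp : Input}

/-- Induction on the unread children. The accumulator starts at an arbitrary value so that the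
induction hypothesis applies after one pass, and the input is described by what remains after the
two read positions. Node values sit at offset 8, clear of the working real registers. One pass takes
ten steps here and seven in `reaches_prodLoop`; both are charged eleven. -/
theorem reaches_sumLoop (idx : V → ℕ) (val : V → ℝ) (rest : List ℕ) (rest' : List ℝ) :
    ∀ (l : List (ℝ × V)) (c : Config), c.pc = 35 →
      inp.words.drop (c.w 5) = (l.map fun a => idx a.2) ++ rest →
      inp.reals.drop (c.w 6) = l.map Prod.fst ++ rest' →
      c.w 10 = c.w 5 + l.length → c.w 7 = 1 → c.w 12 = 8 →
      (∀ a ∈ l, c.r (idx a.2 + 8) = val a.2) →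
      Reaches marginalProgram inp c (11 * l.length + 2) fun c' =>
        c'.pc = 67 ∧ inp.words.drop (c'.w 5) = rest ∧ inp.reals.drop (c'.w 6) = rest' ∧
          c'.r 5 = c.r 5 + (l.map fun a => a.1 * val a.2).sum ∧ SameBase c c' := by
  intro l
  induction l with
  | nil =>
    rintro ⟨pc, w, r⟩ rfl hw hr h10 h7 h12 hv
    dsimp only at *
    refine .next rfl ?_
    simp only [exec, h10, List.length_nil, add_zero, lt_irrefl, if_false]
    refine .next rfl ?_
    simp only [exec]
    refine .refl ⟨rfl, by simpa using hw, by simpa using hr, by simp, ?_⟩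
    exact ⟨fun _ _ _ _ _ _ => rfl, fun _ _ _ _ => rfl⟩
  | cons a l ih =>
    rintro ⟨pc, w, r⟩ rfl hw hr h10 h7 h12 hv
    dsimp only at *
    simp only [List.map_cons, List.cons_append] at hw hr
    have hva := hv a (by simp)
    have hlt : w 5 < w 10 := by simp [h10]
    rw [show 11 * (a :: l).length + 2 = 10 + (11 * l.length + 3) by simp; ring]
    refine Reaches.trans (Q := fun c' => c'.pc = 35 ∧ c'.w 5 = w 5 + 1 ∧ c'.w 6 = w 6 + 1 ∧
      c'.r 5 = r 5 + a.1 * val a.2 ∧ SameBase ⟨35, w, r⟩ c' ∧ c'.w 10 = w 10) ?_ ?_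
    · iterate 10
        refine .next rfl ?_
        simp [exec, Config.setW, Config.setR, hlt, h7, h12, getD_of_drop_eq_cons hw,
          getD_of_drop_eq_cons hr, hva, -List.getD_eq_getElem?_getD]
      refine .refl ⟨rfl, by simp, by simp, by simp [mul_comm], ⟨?_, ?_⟩, by simp⟩
      · intro i h1 h2 h3 h4 h5
        simp [h1, h2, h5]
      · intro i h1 h2 h3
        simp [h1, h2, h3]
    · rintro c' ⟨hpc, h5, h6, hr5, hs, h10'⟩
      refine (ih c' hpc ?_ ?_ ?_ ?_ ?_ ?_).mono (by omega) ?_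
      · rw [h5]; exact drop_succ_of_drop_eq_cons hw
      · rw [h6]; exact drop_succ_of_drop_eq_cons hr
      · rw [h10', h10, h5, List.length_cons]; ring
      · simp [hs.w, h7]
      · simp [hs.w, h12]
      · intro b hb
        rw [hs.r _ (by omega) (by omega) (by omega)]
        exact hv b (by simp [hb])
      · rintro c'' ⟨g1, g2, g3, g4, g5⟩
        refine ⟨g1, g2, g3, ?_, hs.trans g5⟩
        rw [g4, hr5, List.map_cons, List.sum_cons, add_assoc]

theorem reaches_prodLoop (idx : V → ℕ) (val : V → ℝ) (rest : List ℕ) :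
    ∀ (l : List V) (c : Config), c.pc = 47 →
      inp.words.drop (c.w 5) = l.map idx ++ rest →
      c.w 10 = c.w 5 + l.length → c.w 7 = 1 → c.w 12 = 8 →
      (∀ a ∈ l, c.r (idx a + 8) = val a) →
      Reaches marginalProgram inp c (11 * l.length + 2) fun c' =>
        c'.pc = 67 ∧ inp.words.drop (c'.w 5) = rest ∧ c'.w 6 = c.w 6 ∧
          c'.r 5 = c.r 5 * (l.map val).prod ∧ SameBase c c' := by
  intro l
  induction l with
  | nil =>
    rintro ⟨pc, w, r⟩ rfl hw h10 h7 h12 hv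
    dsimp only at *
    refine .next rfl ?_
    simp only [exec, h10, List.length_nil, add_zero, lt_irrefl, if_false]
    refine .next rfl ?_
    simp only [exec]
    refine .refl ⟨rfl, by simpa using hw, rfl, by simp, ?_⟩
    exact ⟨fun _ _ _ _ _ _ => rfl, fun _ _ _ _ => rfl⟩
  | cons a l ih =>
    rintro ⟨pc, w, r⟩ rfl hw h10 h7 h12 hv
    dsimp only at *
    simp only [List.map_cons, List.cons_append] at hw
    have hva := hv a (by simp)
    have hlt : w 5 < w 10 := by simp [h10]
    rw [show 11 * (a :: l).length + 2 = 7 + (11 * l.length + 6) by simp; ring]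
    refine Reaches.trans (Q := fun c' => c'.pc = 47 ∧ c'.w 5 = w 5 + 1 ∧ c'.w 6 = w 6 ∧
      c'.r 5 = r 5 * val a ∧ SameBase ⟨47, w, r⟩ c' ∧ c'.w 10 = w 10) ?_ ?_
    · iterate 7
        refine .next rfl ?_
        simp [exec, Config.setW, Config.setR, hlt, h7, h12, getD_of_drop_eq_cons hw,
          hva, -List.getD_eq_getElem?_getD]
      refine .refl ⟨rfl, by simp, by simp, by simp, ⟨?_, ?_⟩, by simp⟩
      · intro i h1 h2 h3 h4 h5
        simp [h1, h5]
      · intro i h1 h2 h3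
        simp [h1, h2]
    · rintro c' ⟨hpc, h5, h6, hr5, hs, h10'⟩
      refine (ih c' hpc ?_ ?_ ?_ ?_ ?_).mono (by omega) ?_
      · rw [h5]; exact drop_succ_of_drop_eq_cons hw
      · rw [h10', h10, h5, List.length_cons]; ring
      · simp [hs.w, h7]
      · simp [hs.w, h12]
      · intro b hb
        rw [hs.r _ (by omega) (by omega) (by omega)]
        exact hv b (by simp [hb])
      · rintro c'' ⟨g1, g2, g3, g4, g5⟩
        refine ⟨g1, g2, g3.trans h6, ?_, hs.trans g5⟩
        rw [g4, hr5, List.map_cons, List.prod_cons, mul_assoc]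

/-- The value that is substituted for a variable with the query number `q`. -/
def queryValue (q : ℕ) (x : ℝ) : ℝ := if q = 0 then 1 else if q = 1 then x else 0

/-- The value of a gate from the values of the variables and of its children. -/
def gateValue (z : Fin n → ℝ) (val : V → ℝ) : PGCGate n V → ℝ
  | .var i => z i
  | .const a => a
  | .sum l => (l.map fun a => a.1 * val a.2).sum
  | .prod l => (l.map val).prod

/-- The registers that hold constants during the evaluation of the circuit. -/
structure Constants (c : Config) : Prop where
  w7 : c.w 7 = 1
  w8 : c.w 8 = 0
  w12 : c.w 12 = 8
  w13 : c.w 13 = 2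
  r1 : c.r 1 = 1

theorem Constants.of_sameBase {c c' : Config} (h : Constants c) (hs : SameBase c c') :
    Constants c' := by
  obtain ⟨h1, h2, h3, h4, h5⟩ := h
  constructor <;> simp [hs.w, hs.r, *]

/-- The program computes the value of a gate, from the values of its children. -/
theorem reaches_gate (idx : V → ℕ) (val : V → ℝ) (rest : List ℕ) (rest' : List ℝ)
    (g : PGCGate n V) (q : Fin n → ℕ) (hq2 : ∀ i, q i ≤ 2)
    (hq : ∀ i : Fin n, inp.words.getD (i + 2) 0 = q i) (c : Config) (hpc : c.pc = 26)
    (hw : inp.words.drop (c.w 5) = g.words idx ++ rest)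
    (hr : inp.reals.drop (c.w 6) = g.reals ++ rest') (hc : Constants c)
    (hv : ∀ u ∈ g.children, c.r (idx u + 8) = val u) :
    Reaches marginalProgram inp c (11 * g.children.length + 13) fun c' =>
      c'.pc = 67 ∧ inp.words.drop (c'.w 5) = rest ∧ inp.reals.drop (c'.w 6) = rest' ∧
        c'.r 5 = gateValue (fun i => queryValue (q i) (c.r 4)) val g ∧ SameBase c c' := by
  obtain ⟨pc, w, r⟩ := c
  obtain ⟨h7, h8, h12, h13, h1⟩ := hc
  dsimp only at *
  subst hpc
  cases g with
  | var i =>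
    simp only [PGCGate.words, List.cons_append, List.nil_append] at hw
    have hw' := drop_succ_of_drop_eq_cons hw
    have hw'' := drop_succ_of_drop_eq_cons hw'
    simp only [PGCGate.reals, List.nil_append] at hr
    simp only [PGCGate.children, List.length_nil]
    iterate 8
      refine .next rfl ?_
      simp [exec, Config.setW, Config.setR, h7, h13, getD_of_drop_eq_cons hw,
        getD_of_drop_eq_cons hw', hq, -List.getD_eq_getElem?_getD]
    have := hq2 i
    obtain h | h | h : q i = 0 ∨ q i = 1 ∨ q i = 2 := by omega
    · iterate 4
        refine .next rfl ?_
        simp [exec, Config.setR, h7, h8, h]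
      refine .refl ⟨rfl, by simpa using hw'', by simpa using hr,
        by simp [gateValue, queryValue, h], ?_, ?_⟩
      · intro i h1 h2 h3 h4 h5
        simp [h1, h3, h5]
      · intro i h1 h2 h3
        simp [h1]
    · iterate 3
        refine .next rfl ?_
        simp [exec, Config.setR, h7, h8, h]
      refine .refl ⟨rfl, by simpa using hw'', by simpa using hr,
        by simp [gateValue, queryValue, h], ?_, ?_⟩
      · intro i h1 h2 h3 h4 h5
        simp [h1, h3, h5]
      · intro i h1 h2 h3
        simp [h1]
    · refine .next rfl ?_
      simp [exec, h7, h]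
      refine .refl ⟨rfl, by simpa using hw'', by simpa using hr,
        by simp [gateValue, queryValue, h], ?_, ?_⟩
      · intro i h1 h2 h3 h4 h5
        simp [h1, h3, h5]
      · intro i h1 h2 h3
        simp [h1]
  | const a =>
    simp only [PGCGate.words, List.cons_append, List.nil_append] at hw
    have hw' := drop_succ_of_drop_eq_cons hw
    simp only [PGCGate.reals, List.cons_append, List.nil_append] at hr
    have hr' := drop_succ_of_drop_eq_cons hr
    simp only [PGCGate.children, List.length_nil]
    iterate 7
      refine .next rfl ?_
      simp [exec, Config.setW, Config.setR, h7, h13, getD_of_drop_eq_cons hw,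
        getD_of_drop_eq_cons hr, -List.getD_eq_getElem?_getD]
    refine .refl ⟨rfl, by simpa using hw', by simpa using hr', by simp [gateValue], ?_, ?_⟩
    · intro i h1 h2 h3 h4 h5
      simp [h1, h2, h3]
    · intro i h1 h2 h3
      simp [h1]
  | sum l =>
    simp only [PGCGate.words, List.cons_append] at hw
    have hw' := drop_succ_of_drop_eq_cons hw
    have hw'' := drop_succ_of_drop_eq_cons hw'
    simp only [PGCGate.reals] at hr
    simp only [PGCGate.children, List.mem_map, forall_exists_index, and_imp,
      forall_apply_eq_imp_iff₂] at hv
    rw [show 11 * (PGCGate.sum (n := n) l).children.length + 13 = 9 + (11 * l.length + 4) by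
      simp [PGCGate.children]; ring]
    refine Reaches.trans (Q := fun c' => c'.pc = 35 ∧ c'.w 5 = w 5 + 2 ∧ c'.w 6 = w 6 ∧
      c'.r 5 = 0 ∧ c'.w 10 = w 5 + 2 + l.length ∧ SameBase ⟨26, w, r⟩ c') ?_ ?_
    · iterate 9
        refine .next rfl ?_
        simp [exec, Config.setW, Config.setR, h7, h13, getD_of_drop_eq_cons hw,
          getD_of_drop_eq_cons hw', -List.getD_eq_getElem?_getD]
      refine .refl ⟨rfl, by simp, by simp, by simp, by simp; ring, ?_, ?_⟩
      · intro i h1 h2 h3 h4 h5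
        simp [h1, h3, h4]
      · intro i h1 h2 h3
        simp [h1]
    · rintro c' ⟨hpc, h5, h6, hr5, h10, hs⟩
      refine (reaches_sumLoop idx val rest rest' l c' hpc (by rw [h5]; exact hw'')
        (by rw [h6]; exact hr) (by rw [h10, h5]) (by simp [hs.w, h7]) (by simp [hs.w, h12])
        fun a ha => ?_).mono (by omega) ?_
      · rw [hs.r _ (by omega) (by omega) (by omega)]
        exact hv a ha
      · rintro c'' ⟨g1, g2, g3, g4, g5⟩
        refine ⟨g1, g2, g3, ?_, hs.trans g5⟩
        rw [g4, hr5, zero_add, gateValue]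
  | prod l =>
    simp only [PGCGate.words, List.cons_append] at hw
    have hw' := drop_succ_of_drop_eq_cons hw
    have hw'' := drop_succ_of_drop_eq_cons hw'
    simp only [PGCGate.reals, List.nil_append] at hr
    simp only [PGCGate.children] at hv ⊢
    rw [show 11 * l.length + 13 = 9 + (11 * l.length + 4) by ring]
    refine Reaches.trans (Q := fun c' => c'.pc = 47 ∧ c'.w 5 = w 5 + 2 ∧ c'.w 6 = w 6 ∧
      c'.r 5 = 1 ∧ c'.w 10 = w 5 + 2 + l.length ∧ SameBase ⟨26, w, r⟩ c') ?_ ?_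
    · iterate 9
        refine .next rfl ?_
        simp [exec, Config.setW, Config.setR, h7, h13, getD_of_drop_eq_cons hw,
          getD_of_drop_eq_cons hw', -List.getD_eq_getElem?_getD]
      refine .refl ⟨rfl, by simp, by simp, by simp, by simp; ring, ?_, ?_⟩
      · intro i h1 h2 h3 h4 h5
        simp [h1, h3, h4]
      · intro i h1 h2 h3
        simp [h1]
    · rintro c' ⟨hpc, h5, h6, hr5, h10, hs⟩
      refine (reaches_prodLoop idx val rest l c' hpc (by rw [h5]; exact hw'')
        (by rw [h10, h5]) (by simp [hs.w, h7]) (by simp [hs.w, h12])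
        fun a ha => ?_).mono (by omega) ?_
      · rw [hs.r _ (by omega) (by omega) (by omega)]
        exact hv a ha
      · rintro c'' ⟨g1, g2, g3, g4, g5⟩
        refine ⟨g1, g2, ?_, ?_, hs.trans g5⟩
        · rw [g3, h6]; exact hr
        · rw [g4, hr5, one_mul, gateValue]

end Gate

end RealRAM

/-! ### Circuits: evaluation, number of nodes, layout of the input -/

namespace PGC

variable {n : ℕ} (P : PGC n)

theorem eval_nodePolynomial (z : Fin n → ℝ) (v : P.Node) :
    MvPolynomial.eval z (P.nodePolynomial v) =
      RealRAM.gateValue z (fun u => MvPolynomial.eval z (P.nodePolynomial u)) (P.gate v) := by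
  rw [nodePolynomial_eq]
  cases P.gate v with
  | var i => simp [PGCGate.combine, RealRAM.gateValue]
  | const a => simp [PGCGate.combine, RealRAM.gateValue]
  | sum l => simp [PGCGate.combine, RealRAM.gateValue, map_list_sum, Function.comp_def]
  | prod l => simp [PGCGate.combine, RealRAM.gateValue, map_list_prod, Function.comp_def]

/-- Every node except the root is a child of some node, so the child lists together cover all other
nodes. -/
theorem card_node_le_size : Fintype.card P.Node ≤ P.size + 1 := by
  classical
  have h : Finset.univ.erase P.root ⊆
      Finset.univ.biUnion fun v => (P.gate v).children.toFinset := by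
    intro u hu
    have := mt (P.no_parent_iff u).1 (Finset.ne_of_mem_erase hu)
    push Not at this
    simpa using this
  have h1 := (Finset.card_le_card h).trans Finset.card_biUnion_le
  have h2 : ∑ v, (P.gate v).children.toFinset.card ≤ P.size :=
    Finset.sum_le_sum fun v _ => List.toFinset_card_le _
  rw [Finset.card_erase_of_mem (Finset.mem_univ _), Finset.card_univ] at h1
  omega

variable {P}

theorem card_node_pos : 0 < Fintype.card P.Node := Fintype.card_pos_iff.2 ⟨P.root⟩

/-- A parent of the last node would have to come after it; so the last node has no parent and must
be the root. This tells the program where to find the result. -/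
theorem BottomUpOrder.root_eq (e : P.BottomUpOrder) :
    (e.toEquiv.symm P.root : ℕ) = Fintype.card P.Node - 1 := by
  have hpos := P.card_node_pos
  set last := e.toEquiv ⟨Fintype.card P.Node - 1, by omega⟩ with hlast
  have : last = P.root := by
    rw [← P.no_parent_iff]
    intro v hv
    have h1 := e.lt_of_child _ _ hv
    have h2 := (e.toEquiv.symm v).isLt
    rw [hlast, Equiv.symm_apply_apply, Fin.lt_def] at h1
    simp only at h1
    omega
  rw [← this, hlast, Equiv.symm_apply_apply]

/-- The number that describes the role of the variable `i` in a query. -/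
def queryNumber (A B : Finset (Fin n)) (i : Fin n) : ℕ :=
  if i ∈ A then 1 else if i ∈ B then 2 else 0

theorem queryNumber_le (A B : Finset (Fin n)) (i : Fin n) : queryNumber A B i ≤ 2 := by
  unfold queryNumber
  split_ifs <;> omega

/-- The point at which the circuit is evaluated: `x` on `A`, 0 on `B`, and 1 elsewhere. -/
def queryPoint (A B : Finset (Fin n)) (x : ℝ) (i : Fin n) : ℝ :=
  RealRAM.queryValue (queryNumber A B i) x

/-- The words of the gates, in the order of the nodes. -/
def gateWords (e : P.BottomUpOrder) : List (List ℕ) :=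
  List.ofFn fun j => (P.gate (e.toEquiv j)).words fun v => (e.toEquiv.symm v : ℕ)

/-- The real numbers of the gates, in the order of the nodes. -/
def gateReals (e : P.BottomUpOrder) : List (List ℝ) :=
  List.ofFn fun j => (P.gate (e.toEquiv j)).reals

variable (e : P.BottomUpOrder) (A B : Finset (Fin n))

theorem encode_words : (P.encode e A B).words =
    n :: Fintype.card P.Node :: (List.ofFn (queryNumber A B) ++ (gateWords e).flatten) := rfl

theorem encode_words_drop :
    (P.encode e A B).words.drop (n + 2) = (gateWords e).flatten := by
  simp [encode_words]

theorem encode_words_getD (i : Fin n) :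
    (P.encode e A B).words.getD (i + 2) 0 = queryNumber A B i := by
  simp [encode_words, List.getElem?_append]

end PGC

namespace RealRAM

/-! ### The loop over the nodes -/

variable {n : ℕ} {P : PGC n} (e : P.BottomUpOrder) (A B : Finset (Fin n))

/-- The state of the loop over the nodes, entered at `c₀`, when the first `v` nodes are done. -/
structure NodeLoop (x : ℝ) (c₀ : Config) (v : ℕ) (c : Config) : Prop where
  pc : c.pc = 24
  w4 : c.w 4 = v
  words : (P.encode e A B).words.drop (c.w 5) = ((PGC.gateWords e).drop v).flatten
  reals : (P.encode e A B).reals.drop (c.w 6) = ((PGC.gateReals e).drop v).flatten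
  const : Constants c
  w : ∀ i, i ≠ 4 → i ≠ 5 → i ≠ 6 → i ≠ 9 → i ≠ 10 → i ≠ 11 → c.w i = c₀.w i
  r : ∀ i < 5, c.r i = c₀.r i
  values : ∀ u, (e.toEquiv.symm u : ℕ) < v → c.r (e.toEquiv.symm u + 8) =
    MvPolynomial.eval (PGC.queryPoint A B x) (P.nodePolynomial u)

/-- The number of steps for the node at position `v`. -/
def nodeCost (v : ℕ) : ℕ :=
  if h : v < Fintype.card P.Node then 11 * (P.gate (e.toEquiv ⟨v, h⟩)).children.length + 18 else 0

theorem reaches_node {x : ℝ} {c₀ c : Config} {v : ℕ} (hx : c₀.r 4 = x)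
    (hN : c₀.w 1 = Fintype.card P.Node) (hv : v < Fintype.card P.Node)
    (hc : NodeLoop e A B x c₀ v c) :
    Reaches marginalProgram (P.encode e A B) c (nodeCost e v) (NodeLoop e A B x c₀ (v + 1)) := by
  obtain ⟨pc, w, r⟩ := c
  obtain ⟨hpc, h4, hw, hr, hk, hfw, hfr, hval⟩ := hc
  dsimp only at *
  subst hpc
  have h1 : w 1 = Fintype.card P.Node := by rw [hfw] <;> simp [hN]
  set u := e.toEquiv ⟨v, hv⟩ with hu
  have hw' : (P.encode e A B).words.drop (w 5) =
      ((P.gate u).words fun v => (e.toEquiv.symm v : ℕ)) ++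
        ((PGC.gateWords e).drop (v + 1)).flatten := by
    rw [hw, List.drop_eq_getElem_cons (by simpa [PGC.gateWords] using hv)]
    simp [PGC.gateWords, u]
  have hr' : (P.encode e A B).reals.drop (w 6) =
      (P.gate u).reals ++ ((PGC.gateReals e).drop (v + 1)).flatten := by
    rw [hr, List.drop_eq_getElem_cons (by simpa [PGC.gateReals] using hv)]
    simp [PGC.gateReals, u]
  -- One step for the loop test, at most 11 per child plus 13 for the gate, and four to store the
  -- value and return.
  rw [nodeCost, dif_pos hv, ← hu,
    show 11 * (P.gate u).children.length + 18 =
      (11 * (P.gate u).children.length + 13 + 4) + 1 by ring]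
  refine .next rfl ?_
  simp only [exec, h4, h1, hv, if_true]
  refine Reaches.trans (t' := 4) (reaches_gate (fun v => (e.toEquiv.symm v : ℕ))
    (fun u => MvPolynomial.eval (PGC.queryPoint A B x) (P.nodePolynomial u))
    _ _ (P.gate u) (PGC.queryNumber A B) (PGC.queryNumber_le A B)
    (PGC.encode_words_getD e A B) ⟨26, w, r⟩ rfl hw' hr' ⟨hk.1, hk.2, hk.3, hk.4, hk.5⟩ ?_) ?_
  · intro u' hu'
    refine hval u' ?_
    have := e.lt_of_child _ _ hu'
    rw [hu, Equiv.symm_apply_apply, Fin.lt_def] at this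
    exact this
  · rintro ⟨pc', w', r'⟩ ⟨hpc', hw'', hr'', h5, hs⟩
    dsimp only at *
    subst hpc'
    have hk' : Constants ⟨67, w', r'⟩ :=
      Constants.of_sameBase (c := ⟨26, w, r⟩) ⟨hk.1, hk.2, hk.3, hk.4, hk.5⟩ hs
    obtain ⟨h7', h8', h12', h13', h1'⟩ := hk'
    obtain ⟨hsw, hsr⟩ := hs
    dsimp only at *
    have h4' : w' 4 = v := by rw [hsw] <;> simp [h4]
    iterate 4
      refine .next rfl ?_
      simp [exec, Config.setW, Config.setR, h7', h12', h4']
    refine .refl ⟨rfl, by simp, by simpa using hw'', by simpa using hr'', ?_, ?_, ?_, ?_⟩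
    · constructor <;> simp [*]
    · intro i g4 g5 g6 g9 g10 g11
      simp [g4, g11, hsw _ g5 g6 g9 g10 g11, hfw _ g4 g5 g6 g9 g10 g11]
    · intro i hi
      have g : i ≠ v + 8 := by omega
      simp [g, hsr i (by omega) (by omega) (by omega), hfr i hi]
    · intro u' hu'
      have hval' : r' 5 = MvPolynomial.eval (PGC.queryPoint A B x) (P.nodePolynomial u) := by
        rw [h5, P.eval_nodePolynomial, hfr 4 (by omega), hx]
        rfl
      -- Either the value was just stored, or it belongs to an earlier node, whose register the
      -- store does not touch.
      by_cases h : (e.toEquiv.symm u' : ℕ) = v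
      · have : u' = u := by
          rw [hu, ← Equiv.symm_apply_eq, Fin.ext_iff, h]
        rw [h, this]
        simpa using hval'
      · dsimp only
        rw [Function.update_of_ne (by omega), hsr _ (by omega) (by omega) (by omega)]
        exact hval u' (by omega)

/-- The numbering is a bijection, so the child counts add up to the number of edges. -/
theorem sum_nodeCost :
    ∑ v ∈ Finset.range (Fintype.card P.Node), nodeCost e v =
      11 * P.size + 18 * Fintype.card P.Node := by
  rw [Finset.sum_range]
  simp only [nodeCost, Fin.is_lt, dite_true, Fin.eta, Finset.sum_add_distrib, Finset.sum_const,
    ← Finset.mul_sum, Finset.card_univ, Fintype.card_fin, smul_eq_mul, PGC.size]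
  rw [Equiv.sum_comp e.toEquiv fun u => (P.gate u).children.length]
  ring

theorem reaches_nodes {x : ℝ} {c₀ : Config} (hx : c₀.r 4 = x)
    (hN : c₀.w 1 = Fintype.card P.Node) (hc : NodeLoop e A B x c₀ 0 c₀) :
    ∀ v ≤ Fintype.card P.Node,
      Reaches marginalProgram (P.encode e A B) c₀ (∑ i ∈ Finset.range v, nodeCost e i)
        (NodeLoop e A B x c₀ v) := by
  intro v
  induction v with
  | zero => exact fun _ => .refl hc
  | succ v ih =>
    intro hv
    rw [Finset.sum_range_succ]
    exact (ih (by omega)).trans fun c' hc' => reaches_node e A B hx hN hv hc'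

/-! ### The weights and the loop over the evaluation points -/

/-- The weight of the value at `j` in the `k`-th finite difference, divided by `k!`. -/
noncomputable def differenceWeight (k j : ℕ) : ℝ :=
  (-1) ^ (k + j) * (k.choose j : ℝ) / (k.factorial : ℝ)

/-- This recurrence lets the program update the weight in constant time, without factorials or
binomials. The case j = k is included and gives weight 0; the update after the last point uses it.
-/
theorem differenceWeight_succ {k j : ℕ} (h : j ≤ k) :
    differenceWeight k (j + 1) = -(differenceWeight k j * (k - j) / (j + 1)) := by
  have h1 : (k.choose (j + 1) : ℝ) * (j + 1) = k.choose j * (k - j) := by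
    have := Nat.choose_succ_right_eq k j
    rw [← Nat.cast_sub h]
    exact_mod_cast this
  have h2 : (k.choose (j + 1) : ℝ) = k.choose j * (k - j) / (j + 1) := by
    field_simp
    exact h1
  rw [differenceWeight, differenceWeight, h2, ← add_assoc, pow_succ]
  ring

/-- The value of the circuit when `x` is substituted on `A`, 0 on `B`, and 1 elsewhere. -/
noncomputable def circuitValue (P : PGC n) (A B : Finset (Fin n)) (x : ℝ) : ℝ :=
  MvPolynomial.eval (PGC.queryPoint A B x) P.polynomial

/-- The state of the loop over the evaluation points, when the first `j` points are done. -/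
structure PointLoop (P : PGC n) (A B : Finset (Fin n)) (j : ℕ) (c : Config) : Prop where
  pc : c.pc = 20
  w1 : c.w 1 = Fintype.card P.Node
  w2 : c.w 2 = A.card
  w3 : c.w 3 = j
  w14 : c.w 14 = n + 2
  const : Constants c
  r0 : c.r 0 = ∑ i ∈ Finset.range j, differenceWeight A.card i * circuitValue P A B i
  r2 : c.r 2 = differenceWeight A.card j
  r3 : c.r 3 = A.card - j
  r4 : c.r 4 = j

theorem reaches_point {c : Config} {j : ℕ} (hj : j ≤ A.card) (hc : PointLoop P A B j c) :
    Reaches marginalProgram (P.encode e A B) c (11 * P.size + 18 * Fintype.card P.Node + 19)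
      (PointLoop P A B (j + 1)) := by
  obtain ⟨pc, w, r⟩ := c
  obtain ⟨hpc, h1, h2, h3, h14, ⟨h7, h8, h12, h13, hr1⟩, h0, hr2, hr3, hr4⟩ := hc
  dsimp only at *
  subst hpc
  rw [show 11 * P.size + 18 * Fintype.card P.Node + 19 =
    (11 * P.size + 18 * Fintype.card P.Node + 15) + 4 by ring]
  have hlt : ¬ A.card < j := by omega
  iterate 4
    refine .next rfl ?_
    simp [exec, Config.setW, h2, h3, hlt, h14, h8]
  set c₀ : Config := ⟨24, _, r⟩ with hc₀
  have hk₀ : Constants c₀ := by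
    constructor <;> simp [*]
  have := reaches_nodes e A B (x := j) (c₀ := c₀) hr4 (by simp [hc₀, h1])
    ⟨rfl, by simp [hc₀], by simpa [hc₀] using PGC.encode_words_drop e A B, ?_, hk₀,
      fun _ _ _ _ _ _ _ => rfl, fun _ _ => rfl, fun _ h => absurd h (by omega)⟩ _ le_rfl
  · rw [sum_nodeCost] at this
    refine this.trans ?_
    rintro ⟨pc', w', r'⟩ ⟨hpc', h4', -, -, ⟨h7', h8', h12', h13', hr1'⟩, hw', hr', hval⟩
    dsimp only at *
    subst hpc'
    have h1' : w' 1 = Fintype.card P.Node := by rw [hw'] <;> simp [hc₀, h1]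
    have h2' : w' 2 = A.card := by rw [hw'] <;> simp [hc₀, h2]
    have h3' : w' 3 = j := by rw [hw'] <;> simp [hc₀, h3]
    have h14' : w' 14 = n + 2 := by rw [hw'] <;> simp [hc₀, h14]
    have g0 := hr' 0 (by omega)
    have g2 := hr' 2 (by omega)
    have g3 := hr' 3 (by omega)
    have g4 := hr' 4 (by omega)
    simp only [hc₀, h0, hr2, hr3, hr4] at g0 g2 g3 g4
    have hroot : r' (Fintype.card P.Node + 7) = circuitValue P A B j := by
      have hpos := P.card_node_pos
      have := hval P.root (by rw [e.root_eq]; omega)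
      rwa [e.root_eq, show Fintype.card P.Node - 1 + 8 = Fintype.card P.Node + 7 by omega]
        at this
    -- The machine would get stuck on a zero divisor; the point is incremented before the division,
    -- so the divisor is j + 1.
    have hj1 : (j : ℝ) + 1 ≠ 0 := by positivity
    -- Two steps leave the node loop and thirteen add the weighted value and advance. The zero in
    -- real register 7 is set afresh, since sum gates use that register as scratch.
    iterate 15
      refine .next rfl ?_
      simp [exec, Config.setW, Config.setR, h1', h4', h3', h7', h12', hr1', hroot, g0, g2, g3, g4,
        hj1]
    refine .refl ⟨rfl, by simp [h1'], by simp [h2'], by simp, by simp [h14'], ?_, ?_, ?_, ?_, ?_⟩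
    · constructor <;> simp [*]
    · simp [Finset.sum_range_succ, mul_comm]
    · simp [differenceWeight_succ hj]
    · simp
      ring
    · simp
  · simp [hc₀, PGC.encode, PGC.gateReals]

theorem reaches_points {c : Config} (hc : PointLoop P A B 0 c) :
    ∀ j ≤ A.card + 1,
      Reaches marginalProgram (P.encode e A B) c
        (j * (11 * P.size + 18 * Fintype.card P.Node + 19)) (PointLoop P A B j) := by
  intro j
  induction j with
  | zero => exact fun _ => .refl hc
  | succ j ih =>
    intro hj
    rw [Nat.succ_mul]
    exact (ih (by omega)).trans fun c' hc' => reaches_point e A B (by omega) hc'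

/-! ### Counting A, and the complete run -/

/-- The elements of `A` below `i`. -/
def below (A : Finset (Fin n)) (i : ℕ) : Finset (Fin n) := A.filter (·.val < i)

/-- The state of the loop that counts the elements of `A`, after the first `i` variables. -/
structure CountLoop (P : PGC n) (A : Finset (Fin n)) (i : ℕ) (c : Config) : Prop where
  pc : c.pc = 9
  w1 : c.w 1 = Fintype.card P.Node
  w2 : c.w 2 = (below A i).card
  w3 : c.w 3 = 0
  w5 : c.w 5 = i + 2
  w14 : c.w 14 = n + 2
  const : Constants c
  r0 : c.r 0 = 0
  r2 : c.r 2 = differenceWeight (below A i).card 0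
  r3 : c.r 3 = (below A i).card
  r4 : c.r 4 = 0
  r7 : c.r 7 = 0

/-- Each element of A divides the weight by the new count and flips its sign, so the loop ends with
(-1)^k / k!, the weight of the point 0. -/
theorem reaches_count {c : Config} {i : ℕ} (hi : i < n) (hc : CountLoop P A i c) :
    Reaches marginalProgram (P.encode e A B) c 10 (CountLoop P A (i + 1)) := by
  obtain ⟨pc, w, r⟩ := c
  obtain ⟨hpc, h1, h2, h3, h5, h14, ⟨h7, h8, h12, h13, hr1⟩, h0, hr2, hr3, hr4, hr7⟩ := hc
  dsimp only at *
  subst hpc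
  have hq := PGC.encode_words_getD e A B ⟨i, hi⟩
  have hlt : i + 2 < n + 2 := by omega
  by_cases hA : (⟨i, hi⟩ : Fin n) ∈ A
  · have hq' : (P.encode e A B).words.getD (i + 2) 0 = 1 := by
      rw [hq, PGC.queryNumber, if_pos hA]
    have hcard : (below A (i + 1)).card = (below A i).card + 1 := by
      have : below A (i + 1) = insert ⟨i, hi⟩ (below A i) := by
        ext a
        simp only [below, Finset.mem_filter, Finset.mem_insert, Fin.ext_iff]
        constructor
        · rintro ⟨h, h'⟩
          by_cases h'' : a.val = i
          · exact .inl h''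
          · exact .inr ⟨h, by omega⟩
        · rintro (h | ⟨h, h'⟩)
          · obtain rfl : a = ⟨i, hi⟩ := Fin.ext h
            exact ⟨hA, by simp⟩
          · exact ⟨h, by omega⟩
      rw [this, Finset.card_insert_of_notMem (by simp [below])]
    have hne : (((below A i).card : ℕ) : ℝ) + 1 ≠ 0 := by positivity
    iterate 10
      refine .next rfl ?_
      simp [exec, Config.setW, Config.setR, h2, h5, h14, hlt, h7, hr1, hr2, hr3, hr7, hq', hne,
        -List.getD_eq_getElem?_getD]
    refine .refl ⟨rfl, by simp [h1], by simp [hcard], by simp [h3], by simp, by simp [h14],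
      ?_, by simp [h0], ?_, by simp [hcard], by simp [hr4], by simp [hr7]⟩
    · constructor <;> simp [*]
    · simp [hcard, differenceWeight, Nat.factorial_succ, pow_succ]
      field_simp
  · have hcard : below A (i + 1) = below A i := by
      ext a
      simp only [below, Finset.mem_filter, and_congr_right_iff]
      intro h
      have : a.val ≠ i := fun h' => hA (by rwa [show (⟨i, hi⟩ : Fin n) = a from Fin.ext h'.symm])
      omega
    by_cases hB : (⟨i, hi⟩ : Fin n) ∈ B
    · have hq' : (P.encode e A B).words.getD (i + 2) 0 = 2 := by
        rw [hq, PGC.queryNumber, if_neg hA, if_pos hB]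
      iterate 5
        refine .next rfl ?_
        simp [exec, Config.setW, h5, h14, hi, h7, hq', -List.getD_eq_getElem?_getD]
      refine .refl ⟨rfl, by simp [h1], by simp [hcard, h2], by simp [h3], by simp,
        by simp [h14], ?_, by simp [h0], by simp [hcard, hr2], by simp [hcard, hr3],
        by simp [hr4], by simp [hr7]⟩
      constructor <;> simp [*]
    · have hq' : (P.encode e A B).words.getD (i + 2) 0 = 0 := by
        rw [hq, PGC.queryNumber, if_neg hA, if_neg hB]
      iterate 4
        refine .next rfl ?_
        simp [exec, Config.setW, h5, h14, hi, h7, hq', -List.getD_eq_getElem?_getD]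
      refine .refl ⟨rfl, by simp [h1], by simp [hcard, h2], by simp [h3], by simp,
        by simp [h14], ?_, by simp [h0], by simp [hcard, hr2], by simp [hcard, hr3],
        by simp [hr4], by simp [hr7]⟩
      constructor <;> simp [*]

theorem reaches_counts {c : Config} (hc : CountLoop P A 0 c) :
    ∀ i ≤ n, Reaches marginalProgram (P.encode e A B) c (i * 10) (CountLoop P A i) := by
  intro i
  induction i with
  | zero => exact fun _ => .refl hc
  | succ i ih =>
    intro hi
    rw [Nat.succ_mul]
    exact (ih (by omega)).trans fun c' hc' => reaches_count e A B hi hc'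

/-- The program halts with a `k`-th finite difference of the values of the circuit. -/
theorem computesWithin_marginalProgram :
    ∃ t ≤ 9 + (n * 10 + (2 + ((A.card + 1) * (11 * P.size + 18 * Fintype.card P.Node + 19) + 1))),
      ComputesWithin marginalProgram (P.encode e A B) t
        (∑ j ∈ Finset.range (A.card + 1), differenceWeight A.card j * circuitValue P A B j) := by
  have h : Reaches marginalProgram (P.encode e A B) start 9 (CountLoop P A 0) := by
    unfold start
    iterate 9
      refine .next rfl ?_
      simp [exec, Config.setW, Config.setR, PGC.encode_words]
    refine .refl ⟨rfl, by simp, by simp [below], by simp, by simp, by simp, ?_, by simp,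
      by simp [differenceWeight, below], by simp [below], by simp, by simp⟩
    constructor <;> simp
  -- The goal is by definition a `Reaches` statement from `start`, so the phases can be chained.
  refine h.trans (t' := _) (Q' := fun c => marginalProgram.length ≤ c.pc ∧ c.r 0 = _) fun c hc => ?_
  refine (reaches_counts e A B hc n le_rfl).trans fun c hc => ?_
  have hA : below A n = A := by simp [below]
  refine Reaches.trans (Q := PointLoop P A B 0) ?_ fun c hc => ?_
  · obtain ⟨pc, w, r⟩ := c
    obtain ⟨hpc, h1, h2, h3, h5, h14, hk, h0, hr2, hr3, hr4, -⟩ := hc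
    rw [hA] at h2 hr2 hr3
    dsimp only at *
    subst hpc
    iterate 2
      refine .next rfl ?_
      simp [exec, h5, h14]
    exact .refl ⟨rfl, h1, h2, h3, h14, ⟨hk.1, hk.2, hk.3, hk.4, hk.5⟩, by simp [h0], hr2,
      by simp [hr3], by simp [hr4]⟩
  · refine (reaches_points e A B hc _ le_rfl).trans fun c hc => ?_
    obtain ⟨pc, w, r⟩ := c
    obtain ⟨hpc, -, h2, h3, -, -, h0, -, -, -⟩ := hc
    dsimp only at *
    subst hpc
    refine .next rfl ?_
    -- After k + 1 points the test k < k + 1 jumps to position 84, which is the length of the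
    -- program.
    simp only [exec, h2, h3, lt_add_one, if_true]
    exact .refl ⟨le_rfl, h0⟩

end RealRAM

/-! ### Finite differences of monomials -/

namespace RealRAM

/-- The sum is the k-th forward difference of x^i at 0, divided by k!. This difference is k! for i =
k and vanishes for smaller i. -/
theorem sum_differenceWeight_mul_pow {k i : ℕ} (h : i ≤ k) :
    ∑ j ∈ Finset.range (k + 1), differenceWeight k j * (j : ℝ) ^ i = if i = k then 1 else 0 := by
  have h1 := fwdDiff_iter_eq_sum_shift (1 : ℝ) (fun r : ℝ => r ^ i) k 0
  have h2 : ∑ j ∈ Finset.range (k + 1), differenceWeight k j * (j : ℝ) ^ i =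
      (fwdDiff (1 : ℝ))^[k] (fun r : ℝ => r ^ i) 0 / (k.factorial : ℝ) := by
    rw [h1, Finset.sum_div]
    refine Finset.sum_congr rfl fun j hj => ?_
    have hjk : j ≤ k := Nat.lt_succ_iff.1 (Finset.mem_range.1 hj)
    -- The weights use k + j to avoid truncated subtraction; the exponents differ by the even number
    -- 2j.
    have hs : (-1 : ℝ) ^ (k + j) = (-1) ^ (k - j) := by
      rw [show k + j = (k - j) + 2 * j by omega, pow_add, pow_mul]
      simp
    simp [differenceWeight, hs]
    ring
  rw [h2]
  split_ifs with hik
  · subst hik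
    rw [fwdDiff_iter_eq_factorial]
    have : (i.factorial : ℝ) ≠ 0 := by positivity
    simp [this]
  · rw [fwdDiff_iter_pow_eq_zero_of_lt (lt_of_le_of_ne h hik)]
    simp

end RealRAM

/-! ### Marginals as leading coefficients -/

section Marginal

variable {n : ℕ} {A B : Finset (Fin n)}

/-- A factor from B kills the product; otherwise only the elements of A contribute a factor other
than 1. Disjointness of A and B matters because the query number tests A first. -/
theorem prod_queryPoint (hAB : Disjoint A B) (S : Finset (Fin n)) (x : ℝ) :
    ∏ i ∈ S, PGC.queryPoint A B x i = if Disjoint S B then x ^ (S ∩ A).card else 0 := by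
  split_ifs with h
  · have : ∀ i ∈ S, PGC.queryPoint A B x i = if i ∈ A then x else 1 := by
      intro i hi
      have hB : i ∉ B := Finset.disjoint_left.1 h hi
      by_cases hA : i ∈ A <;> simp [PGC.queryPoint, RealRAM.queryValue, PGC.queryNumber, hA, hB]
    rw [Finset.prod_congr rfl this, Finset.prod_ite_mem, Finset.prod_const]
  · obtain ⟨i, hi, hB⟩ := Finset.not_disjoint_iff.1 h
    have hA : i ∉ A := fun hA => Finset.disjoint_left.1 hAB hA hB
    refine Finset.prod_eq_zero hi ?_
    simp [PGC.queryPoint, RealRAM.queryValue, PGC.queryNumber, hA, hB]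

/-- The event is the disjoint union of its single assignments, each identified with the set S of
variables equal to 1. -/
theorem marginal_eq_sum (μ : Measure (Fin n → Bool)) [IsFiniteMeasure μ] (A B : Finset (Fin n)) :
    marginal μ A B =
      ∑ S ∈ Finset.univ.filter fun S => Disjoint S B ∧ A ⊆ S, marginal μ S Sᶜ := by
  unfold marginal
  rw [← measureReal_biUnion_finset]
  · congr 1
    ext x
    simp only [Set.mem_ofPred_eq, Finset.mem_filter, Finset.mem_univ, true_and, Set.mem_iUnion,
      exists_prop, Finset.mem_compl]
    constructor
    · rintro ⟨hA, hB⟩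
      refine ⟨Finset.univ.filter fun i => x i = true, ⟨?_, ?_⟩, by simp, by simp⟩
      · rw [Finset.disjoint_left]
        intro i hi hiB
        simp [hB i hiB] at hi
      · intro i hi
        simpa using hA i hi
    · rintro ⟨S, ⟨hSB, hAS⟩, h1, h2⟩
      exact ⟨fun i hi => h1 i (hAS hi), fun i hi => h2 i (Finset.disjoint_right.1 hSB hi)⟩
  · intro S _ T _ hST
    refine Set.disjoint_left.2 fun x hx hx' => hST ?_
    ext i
    simp only [Set.mem_ofPred_eq, Finset.mem_compl] at hx hx'
    by_contra hne
    by_cases hS : i ∈ S <;> by_cases hT : i ∈ T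
    · simp [hS, hT] at hne
    · simpa [hx'.2 i hT] using hx.1 i hS
    · simpa [hx'.1 i hT] using hx.2 i hS
    · simp [hS, hT] at hne
  · exact fun S _ => (Set.toFinite _).measurableSet

theorem eval_generatingPolynomial (μ : Measure (Fin n → Bool)) (z : Fin n → ℝ) :
    MvPolynomial.eval z (generatingPolynomial μ) =
      ∑ S : Finset (Fin n), marginal μ S Sᶜ * ∏ i ∈ S, z i := by
  simp [generatingPolynomial]

/-- The marginal probability is a finite difference of values of the generating polynomial. -/
theorem sum_differenceWeight_mul_eval (μ : Measure (Fin n → Bool)) [IsFiniteMeasure μ]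
    (hAB : Disjoint A B) :
    ∑ j ∈ Finset.range (A.card + 1), RealRAM.differenceWeight A.card j *
      MvPolynomial.eval (PGC.queryPoint A B j) (generatingPolynomial μ) = marginal μ A B := by
  simp only [eval_generatingPolynomial, prod_queryPoint hAB, Finset.mul_sum]
  rw [Finset.sum_comm, marginal_eq_sum μ A B, Finset.sum_filter]
  refine Finset.sum_congr rfl fun S _ => ?_
  by_cases hS : Disjoint S B
  · have hle : (S ∩ A).card ≤ A.card := Finset.card_le_card Finset.inter_subset_right
    -- The top power of x occurs exactly for the sets containing A, so the difference keeps just the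
    -- terms of the marginal.
    have hiff : (S ∩ A).card = A.card ↔ A ⊆ S := by
      rw [← Finset.inter_eq_right]
      exact ⟨fun h => Finset.eq_of_subset_of_card_le Finset.inter_subset_right h.ge,
        fun h => by rw [h]⟩
    have := RealRAM.sum_differenceWeight_mul_pow hle
    simp only [hS, if_true, true_and, mul_left_comm _ (marginal μ S Sᶜ), ← Finset.mul_sum, this,
      hiff, mul_ite, mul_one, mul_zero]
  · simp [hS]

end Marginal

/-! ### The time bound -/

theorem mainTheorem3 :
    ∃ (prog : List RealRAM.Instr) (C : ℝ),
      ∀ (n : ℕ) (P : PGC n) (μ : Measure (Fin n → Bool)) [IsProbabilityMeasure μ],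
        P.polynomial = generatingPolynomial μ →
        ∀ (e : P.BottomUpOrder) (A B : Finset (Fin n)), Disjoint A B →
          ∃ t : ℕ, RealRAM.ComputesWithin prog (P.encode e A B) t (marginal μ A B) ∧
            (1 ≤ P.size → 3 ≤ n →
              (t : ℝ) ≤ C * (P.size * n * Real.log n * Real.log (Real.log n))) ∧
            (t : ℝ) ≤ C * (max 1 (P.size : ℝ) * max 1 (n : ℝ) * max 1 (Real.log n) *
              max 1 (Real.log (Real.log n))) := by
  -- Since 3 > e, log log 3 is positive. Hence log n · log log n is at least δ > 0 for all n ≥ 3,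
  -- and an O(mn) bound can absorb it at the price of 1/δ.
  have hlog3 : 1 < Real.log 3 :=
    (Real.lt_log_iff_exp_lt (by norm_num)).2 (Real.exp_one_lt_d9.trans (by norm_num))
  have hδ : 0 < Real.log 3 * Real.log (Real.log 3) :=
    mul_pos (by linarith) (Real.log_pos hlog3)
  set δ := Real.log 3 * Real.log (Real.log 3) with hδ_def
  refine ⟨RealRAM.marginalProgram, 154 + 154 / δ, fun n P μ _ hP e A B hAB => ?_⟩
  obtain ⟨t, ht, hcomp⟩ := RealRAM.computesWithin_marginalProgram e A B
  simp only [RealRAM.circuitValue, hP, sum_differenceWeight_mul_eval μ hAB] at hcomp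
  have hA : A.card ≤ n := by simpa using Finset.card_le_univ A
  have hN := P.card_node_le_size
  -- With at most m + 1 nodes, a point costs at most 29m + 37 ≤ 66 max(1, m) steps, and there are at
  -- most 2 max(1, n) points. That gives 132; the remaining 10n + 12 steps add at most 22.
  have htm : t ≤ 154 * (max 1 P.size * max 1 n) := by
    have h1 : A.card + 1 ≤ 2 * max 1 n := by omega
    have h2 : 11 * P.size + 18 * Fintype.card P.Node + 19 ≤ 66 * max 1 P.size := by omega
    have h3 := Nat.mul_le_mul h1 h2
    have h4 : max 1 n ≤ max 1 P.size * max 1 n := Nat.le_mul_of_pos_left _ (by omega)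
    have h5 : 2 * max 1 n * (66 * max 1 P.size) = 132 * (max 1 P.size * max 1 n) := by ring
    omega
  have htr : (t : ℝ) ≤ 154 * (max 1 (P.size : ℝ) * max 1 (n : ℝ)) := by exact_mod_cast htm
  refine ⟨t, hcomp, fun hm hn => ?_, ?_⟩
  · have hm' : (1 : ℝ) ≤ P.size := by exact_mod_cast hm
    have hn' : (3 : ℝ) ≤ n := by exact_mod_cast hn
    rw [max_eq_right hm', max_eq_right (by linarith)] at htr
    have hl : Real.log 3 ≤ Real.log n := Real.log_le_log (by norm_num) hn'
    have hll : Real.log (Real.log 3) ≤ Real.log (Real.log n) :=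
      Real.log_le_log (by linarith) hl
    have hδn : δ ≤ Real.log n * Real.log (Real.log n) :=
      mul_le_mul hl hll (Real.log_pos hlog3).le (by linarith)
    calc (t : ℝ) ≤ 154 * (P.size * n) := htr
      _ = 154 / δ * (P.size * n * δ) := by field_simp
      _ ≤ (154 + 154 / δ) * (P.size * n * (Real.log n * Real.log (Real.log n))) := by
        gcongr
        linarith
      _ = _ := by ring
  · have h1 : (1 : ℝ) ≤ max 1 (Real.log n) * max 1 (Real.log (Real.log n)) :=
      one_le_mul_of_one_le_of_one_le (le_max_left _ _) (le_max_left _ _)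
    calc (t : ℝ) ≤ 154 * (max 1 (P.size : ℝ) * max 1 (n : ℝ)) := htr
      _ = 154 * (max 1 (P.size : ℝ) * max 1 (n : ℝ) * 1) := by ring
      _ ≤ (154 + 154 / δ) * (max 1 (P.size : ℝ) * max 1 (n : ℝ) *
          (max 1 (Real.log n) * max 1 (Real.log (Real.log n)))) := by
        gcongr
        exact le_add_of_nonneg_right (by positivity)
      _ = _ := by ring
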